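/- Let $A=\mathbb F_q[T]$, let $\wp$ be the prime ideal generated by a monic irreducible $\varpi\in A$ of degree $d\ge 1$, let $A_\wp$ be the $\wp$-adic completion of $A$, and let $\mathbb C_\wp$ be the completion of an algebraic closure of $\operatorname{Frac}(A_\wp)$, with absolute value $|x|=q^{-v(x)}$ normalized by $|\varpi|=q^{-d}$. Let $\mathcal O\subset\mathbb C_\wp$ be a local subring with maximal ideal $\{x\in\mathcal O: v(x)>0\}$, containing $A_\wp$ and complete for $|\cdot|$. Let $\varphi$ be a Drinfeld module of rank $r\ge 2$ over $\mathcal O$ on $\mathbb G_{a,\mathcal O}$: a ring homomorphism $a\mapsto\varphi_a(X)$ from $A$ to the ring of additive polynomials over $\mathcal O$ (under composition) such that $\varphi_a(X)$ has linear term $aX$ and, for $a\ne 0$, has degree $q^{r\deg a}$ and leading coefficient in $\mathcal O^\times$. Write $$\varphi_\varpi(X)=\sum_{i=0}^{rd}H_iX^{q^i};$$ the coefficient $H_d$ is called the lift of the Hasse invariant. Let $\varphi[\varpi](\mathbb C_\wp)$ be the set of zeros of $\varphi_\varpi$ in $\mathbb C_\wp$, an $A/\wp$-module via $\varphi$, and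 let $\delta_0=\min\{|x| : 0\neq x\in\varphi[\varpi](\mathbb C_\wp)\}$. One says that $\varphi$ admits the *canonical submodule* if $\{x\in\varphi[\varpi](\mathbb C_\wp): |x|\le\delta_0\}$ is a free $A/\wp$-module of rank one via $\varphi$; this set is then the canonical submodule. A *canonical submodule scheme* of $\varphi$ is a closed $A$-submodule scheme $C$ of $\varphi[\varpi]=\operatorname{Spec}\mathcal O[X]/(\varphi_\varpi(X))$ over $\mathcal O$ such that $C(\mathbb C_\wp)$ is the canonical submodule of $\varphi$. The Newton polygon of $\sum_n a_nX^n$ is the lower convex hull of the points $(n,v(a_n))$ with $a_n\ne 0$. **Theorem.** 1. $\varphi$ admits the canonical submodule if and only if $(q^d,v(H_d))$ is a vertex of the Newton polygon of $\varphi_\varpi(X)$ (in particular $H_d\neq 0$). 2. If $\varphi$ admits a canonical submodule scheme, then $(q^d,v(H_d))$ is a vertex of the Newton polygon of $\varphi_\varpi(X)$. 3. Suppose that $\mathcal O$ is a valuation ring. Then $\varphi$ admits a canonical submodule scheme if and only if $(q^d,v(H_d))$ is a vertex of the Newton polygon of $\varphi_\varpi(X)$; and the same holds for canonical submodule schemes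 that are finite and flat over $\mathcal O$. -/

import Mathlib

open Polynomial IsDedekindDomain
open scoped WithZero NNReal

universe u

namespace Drinfeld

noncomputable section

section Fields

variable {Fq : Type u} [Field Fq] [Finite Fq] (P : HeightOneSpectrum Fq[X])

/-- The residue field of a nonzero prime of `A = 𝔽_q[T]` has more than one element and is finite. -/
theorem one_lt_card_residue : (1 : ℝ≥0) < (Nat.card (Fq[X] ⧸ P.asIdeal) : ℝ≥0) := by
  have hfin : Finite (Fq[X] ⧸ P.asIdeal) := by
    obtain ⟨g, hg⟩ := (IsPrincipalIdealRing.principal P.asIdeal).principal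
    have hg0 : g ≠ 0 := by
      rintro rfl
      exact P.ne_bot (by simpa using hg)
    have h : Module.Finite Fq (AdjoinRoot g) := (AdjoinRoot.powerBasis hg0).finite
    have h2 : Finite (AdjoinRoot g) := Module.finite_of_finite Fq
    rw [hg]
    exact h2
  have : Nontrivial (Fq[X] ⧸ P.asIdeal) := Ideal.Quotient.nontrivial_iff.mpr P.isPrime.ne_top
  exact_mod_cast Finite.one_lt_card

/-- The fraction field of `A_℘`: the `℘`-adic completion of `𝔽_q(T)`. -/
abbrev LocalField := P.adicCompletion (RatFunc Fq)

/-- The rank one structure for which a uniformizer has absolute value `(#(A/℘))⁻¹ = q^{-d}`. -/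
instance : (Valued.v : Valuation (LocalField P) ℤᵐ⁰).RankOne :=
  Valuation.IsRankOneDiscrete.rankOne _ (one_lt_card_residue P)

instance : NontriviallyNormedField (LocalField P) :=
  Valued.toNontriviallyNormedField (LocalField P) ℤᵐ⁰

instance : IsUltrametricDist (LocalField P) :=
  IsUltrametricDist.isUltrametricDist_of_forall_norm_add_le_max_norm
    (Valued.isNonarchimedean_norm (LocalField P) ℤᵐ⁰)

instance : CompleteSpace (LocalField P) :=
  inferInstanceAs (CompleteSpace (P.adicCompletion (RatFunc Fq)))

/-- An algebraic closure of the fraction field of `A_℘`. -/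
abbrev AlgCl := AlgebraicClosure (LocalField P)

/-- The absolute value of the local field, extended to its algebraic closure. -/
instance : NormedField (AlgCl P) := spectralNorm.normedField (LocalField P) (AlgCl P)

/-- The field `ℂ_℘`, the completion of an algebraic closure of the fraction field of `A_℘`. -/
abbrev CP := UniformSpace.Completion (AlgCl P)

/-- The embedding of the fraction field of `A_℘` in `ℂ_℘`. -/
def localToCP : LocalField P →+* CP P :=
  UniformSpace.Completion.coeRingHom.comp (algebraMap (LocalField P) (AlgCl P))

/-- The valuation `v` on `ℂ_℘`, with `‖x‖ = q ^ (-v x)`, for `x ≠ 0`.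
(The value at `0`, which ought to be `∞`, is never used.) -/
def val (x : CP P) : ℝ := -Real.logb (Nat.card Fq) ‖x‖

/-- The base rings: complete local subrings `O` of `ℂ_℘` that contain `A_℘`, with
maximal ideal `{x ∈ O | v x > 0}`. -/
structure IsBaseRing (O : Subring (CP P)) : Prop where
  isLocalRing : IsLocalRing O
  mem_maximalIdeal : ∀ x : O, x ∈ IsLocalRing.maximalIdeal O ↔ ‖(x : CP P)‖ < 1
  integers_mem : ∀ a ∈ P.adicCompletionIntegers (RatFunc Fq), localToCP P a ∈ O
  isComplete : IsComplete (O : Set (CP P))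

variable {P} in
/-- The structure map `A → A_℘ ⊆ O`. -/
def IsBaseRing.structureMap {O : Subring (CP P)} (hO : IsBaseRing P O) : Fq[X] →+* O :=
  ((localToCP P).comp (algebraMap Fq[X] (LocalField P))).codRestrict O fun a =>
    hO.integers_mem _ (algebraMap Fq[X] (P.adicCompletionIntegers (RatFunc Fq)) a).2

end Fields

/-- A polynomial `f` is additive, `f(X + Y) = f(X) + f(Y)`, i.e. it is an endomorphism of the
group scheme `𝔾ₐ` over `R`. -/
def IsAdditive {R : Type u} [CommRing R] (f : R[X]) : Prop :=
  aeval (MvPolynomial.X 0 + MvPolynomial.X 1 : MvPolynomial (Fin 2) R) f =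
    aeval (MvPolynomial.X 0 : MvPolynomial (Fin 2) R) f +
      aeval (MvPolynomial.X 1 : MvPolynomial (Fin 2) R) f

theorem IsAdditive.aeval_add {R : Type u} [CommRing R] {f : R[X]} (hf : IsAdditive f)
    {S : Type*} [CommRing S] [Algebra R S] (x y : S) :
    aeval (x + y) f = aeval x f + aeval y f := by
  have h := congrArg (MvPolynomial.aeval (R := R) ![x, y]) hf
  simpa [← aeval_algHom_apply] using h

/-- A Drinfeld module of rank `r` over an `A`-ring `γ : A → R`, `A = 𝔽_q[T]`, on the additive group:
a ring homomorphism `a ↦ φ_a` from `A` to the endomorphism ring of `𝔾ₐ` over `R` (additive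
polynomials, with composition as multiplication), such that `φ_a = γ(a) X + ⋯` has
degree `q ^ (r deg a)` and an invertible leading coefficient for `a ≠ 0`. -/
structure DrinfeldModule {Fq : Type u} [Field Fq] {R : Type u} [CommRing R] (γ : Fq[X] →+* R)
    (r : ℕ) where
  /-- The polynomial `φ_a(X)`. -/
  act : Fq[X] → R[X]
  isAdditive : ∀ a, IsAdditive (act a)
  act_add : ∀ a b, act (a + b) = act a + act b
  act_one : act 1 = X
  act_mul : ∀ a b, act (a * b) = (act a).comp (act b)
  coeff_one : ∀ a, (act a).coeff 1 = γ a
  natDegree_act : ∀ a, a ≠ 0 → (act a).natDegree = Nat.card Fq ^ (r * a.natDegree)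
  isUnit_leadingCoeff : ∀ a, a ≠ 0 → IsUnit (act a).leadingCoeff

namespace DrinfeldModule

section General

variable {Fq : Type u} [Field Fq] {R : Type u} [CommRing R] {γ : Fq[X] →+* R} {r : ℕ}
  (φ : DrinfeldModule γ r)

/-- The `S`-valued points of the additive group, with the `A`-module structure
`a • x = φ_a(x)`. -/
def Points (_φ : DrinfeldModule γ r) (S : Type u) : Type u := S

instance (S : Type u) [CommRing S] : AddCommGroup (φ.Points S) := inferInstanceAs (AddCommGroup S)

instance (S : Type u) [CommRing S] [Algebra R S] : Module Fq[X] (φ.Points S) where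
  smul a x := (aeval (show S from x) (φ.act a) : S)
  one_smul x := by
    change aeval (show S from x) (φ.act 1) = x
    rw [φ.act_one, aeval_X]
  mul_smul a b x := by
    change aeval (show S from x) (φ.act (a * b)) =
      aeval (aeval (show S from x) (φ.act b)) (φ.act a)
    rw [φ.act_mul, aeval_comp]
  smul_zero a := by
    change aeval (0 : S) (φ.act a) = 0
    have h := (φ.isAdditive a).aeval_add (0 : S) 0
    simpa using h
  smul_add a x y := (φ.isAdditive a).aeval_add (show S from x) (show S from y)
  add_smul a b x := by
    change aeval (show S from x) (φ.act (a + b)) =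
      aeval (show S from x) (φ.act a) + aeval (show S from x) (φ.act b)
    rw [φ.act_add, map_add]
  zero_smul x := by
    change aeval (show S from x) (φ.act 0) = 0
    have h : φ.act 0 = 0 := by simpa using φ.act_add 0 0
    rw [h, map_zero]

/-- An `A`-submodule scheme of `φ[a]` over `R`: a closed subscheme `Spec R[X]/I` of
`𝔾ₐ = Spec R[X]` that is contained in `φ[a] = Spec R[X]/(φ_a)`, and whose `S`-valued points form an
`A`-submodule of `𝔾ₐ(S)`, with its module structure via `φ`, for every `R`-algebra `S`. -/
structure SubmoduleScheme (a : Fq[X]) where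
  /-- The ideal `I` that defines the closed subscheme. -/
  ideal : Ideal R[X]
  act_mem : φ.act a ∈ ideal
  isSubmodule : ∀ (S : Type u) [CommRing S] [Algebra R S],
    ∃ N : Submodule Fq[X] (φ.Points S),
      (N : Set (φ.Points S)) = {x : S | ∀ f ∈ ideal, aeval x f = 0}

/-- The `S`-valued points of a submodule scheme. -/
def SubmoduleScheme.points {φ : DrinfeldModule γ r} {a : Fq[X]} (Z : φ.SubmoduleScheme a)
    (S : Type u) [CommRing S] [Algebra R S] : Set (φ.Points S) :=
  {x : S | ∀ f ∈ Z.ideal, aeval x f = 0}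

end General

section Canonical

variable {Fq : Type u} [Field Fq] [Finite Fq] {P : HeightOneSpectrum Fq[X]} {O : Subring (CP P)}
  {γ : Fq[X] →+* O} {r : ℕ} (φ : DrinfeldModule γ r) (ϖ : Fq[X])

/-- The `ℂ_℘`-valued points of `φ[ϖ]`; a module over `A/(ϖ)`. -/
abbrev torsion : Submodule Fq[X] (φ.Points (CP P)) :=
  Submodule.torsionBy Fq[X] (φ.Points (CP P)) ϖ

/-- The absolute value of a torsion point. -/
def absTorsion (x : φ.torsion ϖ) : ℝ := ‖(show CP P from (x : φ.Points (CP P)))‖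

/-- `δ₀`, the least absolute value of a nonzero `ϖ`-torsion point. -/
def delta : ℝ := sInf {t | ∃ x : φ.torsion ϖ, x ≠ 0 ∧ φ.absTorsion ϖ x = t}

/-- `N` is the canonical submodule of `φ`: it is the set of the `ϖ`-torsion points of absolute
value at most `δ₀`, and it is free of rank one over `κ(℘) = A/(ϖ)`. -/
def IsCanonicalSubmodule (N : Submodule (Fq[X] ⧸ Ideal.span {ϖ}) (φ.torsion ϖ)) : Prop :=
  (N : Set (φ.torsion ϖ)) = {x | φ.absTorsion ϖ x ≤ φ.delta ϖ} ∧
    Module.Free (Fq[X] ⧸ Ideal.span {ϖ}) N ∧ Module.rank (Fq[X] ⧸ Ideal.span {ϖ}) N = 1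

/-- `φ` admits the canonical submodule. -/
def AdmitsCanonicalSubmodule : Prop := ∃ N, φ.IsCanonicalSubmodule ϖ N

/-- `Z` is a canonical submodule scheme of `φ`: its set of `ℂ_℘`-valued points is the canonical
submodule. -/
def IsCanonicalSubmoduleScheme (Z : φ.SubmoduleScheme ϖ) : Prop :=
  ∃ N, φ.IsCanonicalSubmodule ϖ N ∧ Z.points (CP P) = (Subtype.val '' (N : Set (φ.torsion ϖ)))

/-- `φ` admits a canonical submodule scheme. -/
def AdmitsCanonicalSubmoduleScheme : Prop := ∃ Z, φ.IsCanonicalSubmoduleScheme ϖ Z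

/-- `φ` admits a canonical submodule scheme that is finite and flat over `O`. -/
def AdmitsFiniteFlatCanonicalSubmoduleScheme : Prop :=
  ∃ Z, φ.IsCanonicalSubmoduleScheme ϖ Z ∧ Module.Finite O (O[X] ⧸ Z.ideal) ∧
    Module.Flat O (O[X] ⧸ Z.ideal)

end Canonical

end DrinfeldModule

/-- The Newton polygon of `f = ∑ aₙ Xⁿ` as the convex region on and above it: the convex hull of the
vertical rays that start at the points `(n, v(aₙ))` with `aₙ ≠ 0` and go upwards. -/
def newtonPolygon {K : Type u} [Field K] (v : K → ℝ) (f : K[X]) : Set (ℝ × ℝ) :=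
  convexHull ℝ {p | ∃ n : ℕ, f.coeff n ≠ 0 ∧ p.1 = n ∧ v (f.coeff n) ≤ p.2}

/-- The point `(n, v(aₙ))` is a vertex of the Newton polygon of `f = ∑ aₙ Xⁿ`. -/
def IsNewtonVertex {K : Type u} [Field K] (v : K → ℝ) (f : K[X]) (n : ℕ) : Prop :=
  f.coeff n ≠ 0 ∧ ((n : ℝ), v (f.coeff n)) ∈ (newtonPolygon v f).extremePoints ℝ

end

end Drinfeld

/-! Each `φ_a` has coefficients of absolute value at most 1 and no constant term, so it does not
increase the absolute value of an integral point. Hence every ball in the `ϖ`-torsion is a vector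
space over the finite field `A/℘`, which has `q^d` elements. The ball of radius `δ₀` contains a
nonzero point, so it has at least `q^d` elements, and it is the canonical submodule exactly when it
has no more. The polynomial `φ_ϖ` is additive with nonzero linear coefficient, so its roots are
simple, and the question is how many roots lie in a ball.

The Newton polygon answers it. At radius `ρ`, the largest value of `|aₘ| ρ^m` is attained at the
number of roots in the open ball, at the number in the closed ball, and nowhere outside these two
indices (`exists_isPeak`). If they agree, a supporting line meets the polygon in a single point, a
vertex (`isNewtonVertex_of_countP_eq`). If they differ, no index strictly between them is a vertex
(`IsNewtonVertex.countP_le`); at `ρ = δ₀` the open ball contains only the root 0.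

A canonical submodule scheme presupposes the canonical submodule, so only its existence over a
valuation ring `O` remains. The fraction field of `O` is closed in `ℂ_℘`, so conjugate elements have
equal absolute values and the roots in a ball are the roots of a monic factor `h` over that field.
Since these roots are integral, `h` has coefficients in `O` (`IsBaseRing.exists_monic`). Its roots
form an `A`-module, so `h` is additive and `O[X]/(h)` is the required finite free scheme. -/

namespace Drinfeld

/-! ### Complete nonarchimedean fields -/

section CompleteFields

/-- A complete nonarchimedean field with a dense algebraically closed subfield is algebraically
closed, in every characteristic. -/
theorem isAlgClosed_of_denseRange {K L : Type*} [Field K] [NontriviallyNormedField L]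
    [CompleteSpace L] [IsUltrametricDist L] [Algebra K L]
    (hi : DenseRange (algebraMap K L)) [IsAlgClosed K] : IsAlgClosed L := by
  apply IsAlgClosed.of_exists_root
  intro f fmon firr
  have hdeg : f.natDegree ≠ 0 := firr.natDegree_pos.ne'
  let F := f.SplittingField
  let : NormedField F := spectralNorm.normedField L F
  let : NormedAlgebra L F := spectralNorm.normedAlgebra L F
  obtain ⟨a, fa⟩ : ∃ a : F, aeval a f = 0 := by
    refine ⟨rootOfSplits (SplittingField.splits f)
      (by simpa using degree_ne_of_natDegree_ne hdeg), ?_⟩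
    rw [← eval_map_algebraMap]
    exact eval_rootOfSplits (SplittingField.splits f) _
  have hclosed : IsClosed (Set.range (algebraMap L F)) :=
    (algebraMap_isometry L F).isClosedEmbedding.isClosed_range
  obtain ⟨b, rfl⟩ : a ∈ Set.range (algebraMap L F) := by
    rw [← hclosed.closure_eq, Metric.mem_closure_iff]
    intro δ hδ
    -- With `n` the degree, continuity of roots gives the bound `((n + 1) ε)^(1/n) * max ‖a‖ 1`;
    -- this `ε` makes it equal to `δ`.
    have hε : (δ / (max ‖a‖ 1)) ^ f.natDegree / (f.natDegree + 1) > 0 := by positivity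
    obtain ⟨g, gmon, gdeg, gcoeff⟩ :=
      exists_monic_and_natDegree_eq_and_norm_map_algebraMap_coeff_sub_lt hi fmon hε
    obtain ⟨b, hb, hab⟩ := exists_aroots_norm_sub_lt_of_norm_coeff_sub_lt
      hε fa fmon (gmon.map _) (gdeg ▸ (g.natDegree_map _)) gcoeff
      (by simpa [Polynomial.map_map] using (IsAlgClosed.splits g).map ((algebraMap L F).comp _))
    rw [aroots_def, Splits.roots_map ((IsAlgClosed.splits g).map _), Multiset.mem_map] at hb
    obtain ⟨c, -, rfl⟩ := hb
    refine ⟨_, ⟨c, rfl⟩, ?_⟩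
    rw [dist_eq_norm]
    refine hab.trans_eq ?_
    rw [mul_div_cancel₀ _ (by positivity), ← Real.rpow_natCast, ← Real.rpow_mul (by positivity),
      mul_inv_cancel₀ (by exact_mod_cast hdeg), Real.rpow_one,
      div_mul_cancel₀ _ (by positivity : (max ‖a‖ 1) > 0).ne']
  refine ⟨b, (algebraMap L F).injective ?_⟩
  rwa [map_zero, ← aeval_algebraMap_apply_eq_algebraMap_eval]

/-- Over a complete nonarchimedean field, all roots of a minimal polynomial have the same absolute
value. -/
theorem norm_eq_of_minpoly_root {L C : Type*} [NontriviallyNormedField L] [CompleteSpace L]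
    [IsUltrametricDist L] [NormedField C] [NormedAlgebra L C] {x y : C} (hx : IsIntegral L x)
    (hy : aeval y (minpoly L x) = 0) : ‖y‖ = ‖x‖ := by
  -- The norm is unique only on algebraic extensions of `L`, and `C` need not be one. On `L(x, y)`
  -- it is the spectral norm, which depends only on the minimal polynomial.
  let E := IntermediateField.adjoin L ({x, y} : Set C)
  have hy' : IsIntegral L y := ⟨_, minpoly.monic hx, hy⟩
  have : Algebra.IsAlgebraic L E :=
    (IntermediateField.isAlgebraic_adjoin (by
      rintro z (rfl | rfl) <;> assumption))
  have hmem : ∀ z : E, ‖(z : C)‖ = spectralNorm L C z := fun z => by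
    rw [← IntermediateField.algebraMap_apply, ← spectralNorm.eq_of_tower,
      ← NormedAlgebra.norm_eq_spectralNorm]
    rfl
  have h1 := hmem ⟨x, IntermediateField.subset_adjoin _ _ (by simp)⟩
  have h2 := hmem ⟨y, IntermediateField.subset_adjoin _ _ (by simp)⟩
  simp only at h1 h2
  rw [h1, h2, spectralNorm, spectralNorm,
    minpoly.eq_of_irreducible_of_monic (minpoly.irreducible hx) hy (minpoly.monic hx)]

end CompleteFields

/-! ### Newton polygons and the number of roots in a ball -/

section Newton

variable {C : Type u} [NormedField C] [IsUltrametricDist C]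

/-- The sequence `A` is bounded by `M`, attains `M` at `k₁` and `k₂`, and not outside `[k₁, k₂]`. -/
def IsPeak (A : ℕ → ℝ) (k₁ k₂ : ℕ) (M : ℝ) : Prop :=
  (∀ m, A m ≤ M) ∧ A k₁ = M ∧ A k₂ = M ∧ ∀ m, m < k₁ ∨ k₂ < m → A m < M

theorem norm_sub_eq_left {x y : C} (h : ‖y‖ < ‖x‖) : ‖x - y‖ = ‖x‖ := by
  rw [sub_eq_add_neg, IsUltrametricDist.norm_add_eq_max_of_norm_ne_norm (by simpa using h.ne'),
    norm_neg, max_eq_left h.le]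

theorem norm_sub_eq_right {x y : C} (h : ‖x‖ < ‖y‖) : ‖x - y‖ = ‖y‖ := by
  rw [norm_sub_rev, norm_sub_eq_left h]

theorem norm_sub_lt {x y : C} {t : ℝ} (hx : ‖x‖ < t) (hy : ‖y‖ < t) : ‖x - y‖ < t := by
  rw [sub_eq_add_neg]
  exact (IsUltrametricDist.norm_add_le_max _ _).trans_lt (max_lt hx (by simpa using hy))

theorem norm_sub_le' {x y : C} {t : ℝ} (hx : ‖x‖ ≤ t) (hy : ‖y‖ ≤ t) : ‖x - y‖ ≤ t := by
  rw [sub_eq_add_neg]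
  exact (IsUltrametricDist.norm_add_le_max _ _).trans (max_le hx (by simpa using hy))

/-- The effect on the peak of the coefficients at radius `ρ` of a multiplication by `X - x`. -/
theorem IsPeak.X_sub_C_mul {ρ : ℝ} (hρ : 0 < ρ) {f : C[X]} {k₁ k₂ : ℕ} {M : ℝ} (hM : 0 < M)
    (h : IsPeak (fun m => ‖f.coeff m‖ * ρ ^ m) k₁ k₂ M) (x : C) :
    IsPeak (fun m => ‖((X - Polynomial.C x) * f).coeff m‖ * ρ ^ m)
      (k₁ + if ‖x‖ < ρ then 1 else 0) (k₂ + if ‖x‖ ≤ ρ then 1 else 0) (max ρ ‖x‖ * M) := by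
  obtain ⟨hle, h1, h2, hlt⟩ := h
  simp only at hle h1 h2 hlt
  have hB0 : ‖((X - Polynomial.C x) * f).coeff 0‖ * ρ ^ 0 = ‖x‖ * (‖f.coeff 0‖ * ρ ^ 0) := by
    simp [sub_mul]
  let c : ℕ → C := fun m => if m = 0 then 0 else f.coeff (m - 1)
  have hcoeff : ∀ m, ((X - Polynomial.C x) * f).coeff m = c m - x * f.coeff m := by
    rintro (_ | m) <;> simp [c, sub_mul]
  have hc0 : c 0 = 0 := by simp [c]
  have hcs : ∀ m, ‖c (m + 1)‖ * ρ ^ (m + 1) = ρ * (‖f.coeff m‖ * ρ ^ m) := fun m => by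
    simp only [c, Nat.succ_ne_zero, if_false, Nat.add_sub_cancel]; ring
  have hcle : ∀ m, ‖c m‖ * ρ ^ m ≤ ρ * M := by
    rintro (_ | m)
    · rw [hc0]; simp; positivity
    · rw [hcs]; gcongr; exact hle m
  have hxm : ∀ m, ‖x * f.coeff m‖ * ρ ^ m = ‖x‖ * (‖f.coeff m‖ * ρ ^ m) := fun m => by
    rw [norm_mul]; ring
  have hxle : ∀ m, ‖x * f.coeff m‖ * ρ ^ m ≤ ‖x‖ * M := fun m => by
    rw [hxm]; gcongr; exact hle m
  have key_le : ∀ m t, ‖c m‖ * ρ ^ m ≤ t → ‖x * f.coeff m‖ * ρ ^ m ≤ t →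
      ‖c m - x * f.coeff m‖ * ρ ^ m ≤ t := fun m t h1 h2 => by
    have hp := pow_pos hρ m
    rw [← le_div_iff₀ hp] at *
    exact norm_sub_le' h1 h2
  have key_lt : ∀ m t, ‖c m‖ * ρ ^ m < t → ‖x * f.coeff m‖ * ρ ^ m < t →
      ‖c m - x * f.coeff m‖ * ρ ^ m < t := fun m t h1 h2 => by
    have hp := pow_pos hρ m
    rw [← lt_div_iff₀ hp] at *
    exact norm_sub_lt h1 h2
  have key_left : ∀ m, ‖x * f.coeff m‖ * ρ ^ m < ‖c m‖ * ρ ^ m →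
      ‖c m - x * f.coeff m‖ * ρ ^ m = ‖c m‖ * ρ ^ m := fun m h => by
    rw [norm_sub_eq_left (lt_of_mul_lt_mul_right h (pow_pos hρ m).le)]
  have key_right : ∀ m, ‖c m‖ * ρ ^ m < ‖x * f.coeff m‖ * ρ ^ m →
      ‖c m - x * f.coeff m‖ * ρ ^ m = ‖x * f.coeff m‖ * ρ ^ m := fun m h => by
    rw [norm_sub_eq_right (lt_of_mul_lt_mul_right h (pow_pos hρ m).le)]
  have hclt : ∀ m, (∀ n, m = n + 1 → n < k₁ ∨ k₂ < n) → ‖c m‖ * ρ ^ m < ρ * M := by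
    rintro (_ | m) hm
    · rw [hc0]; simp; positivity
    · rw [hcs]; gcongr; exact hlt m (hm m rfl)
  have hxlt : 0 < ‖x‖ → ∀ m, m < k₁ ∨ k₂ < m → ‖x * f.coeff m‖ * ρ ^ m < ‖x‖ * M := by
    intro hx m hm
    rw [hxm]; gcongr; exact hlt m hm
  simp only [IsPeak, hcoeff]
  -- The shifted sequence `c` peaks on `[k₁ + 1, k₂ + 1]` at height `ρ M`, the multiple by `x` on
  -- `[k₁, k₂]` at height `‖x‖ M`. The higher one prevails. At equal height, only the second attains
  -- the maximum at `k₁` and only the first at `k₂ + 1`, so nothing cancels there.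
  rcases lt_trichotomy ‖x‖ ρ with hx | hx | hx
  · rw [if_pos hx, if_pos hx.le, max_eq_left hx.le]
    have hxM : ‖x‖ * M < ρ * M := by gcongr
    refine ⟨fun m => key_le m _ (hcle m) ((hxle m).trans hxM.le), ?_, ?_, fun m hm => ?_⟩
    · rw [key_left] <;> rw [hcs, h1]
      exact (hxle _).trans_lt hxM
    · rw [key_left] <;> rw [hcs, h2]
      exact (hxle _).trans_lt hxM
    · exact key_lt m _ (hclt m fun n hn => by omega) ((hxle m).trans_lt hxM)
  · rw [if_neg hx.not_lt, if_pos hx.le, hx, max_self]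
    rw [hx] at hxle hxlt hxm
    refine ⟨fun m => key_le m _ (hcle m) (hxle m), ?_, ?_, fun m hm => ?_⟩
    · rw [add_zero, key_right] <;> rw [hxm, h1]
      exact hclt _ fun n hn => by omega
    · rw [key_left] <;> rw [hcs, h2]
      exact hxlt hρ _ (by omega)
    · exact key_lt m _ (hclt m fun n hn => by omega) (hxlt hρ m (by omega))
  · rw [if_neg hx.not_gt, if_neg hx.not_ge, max_eq_right hx.le, add_zero, add_zero]
    have hxM : ρ * M < ‖x‖ * M := by gcongr
    refine ⟨fun m => key_le m _ ((hcle m).trans hxM.le) (hxle m), ?_, ?_, fun m hm => ?_⟩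
    · rw [key_right] <;> rw [hxm, h1]
      exact (hcle _).trans_lt hxM
    · rw [key_right] <;> rw [hxm, h2]
      exact (hcle _).trans_lt hxM
    · exact key_lt m _ ((hcle m).trans_lt hxM) (hxlt (hρ.trans hx) m hm)

/-- The coefficients of a product of linear factors at radius `ρ` peak between the number of roots
in the open and in the closed ball of radius `ρ`. -/
theorem exists_isPeak_prod {ρ : ℝ} (hρ : 0 < ρ) (s : Multiset C) :
    ∃ M > 0, IsPeak (fun m => ‖((s.map fun x => X - Polynomial.C x).prod).coeff m‖ * ρ ^ m)
      (s.countP (‖·‖ < ρ)) (s.countP (‖·‖ ≤ ρ)) M := by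
  induction s using Multiset.induction_on with
  | empty =>
    refine ⟨1, one_pos, ?_⟩
    simp only [IsPeak, Multiset.map_zero, Multiset.prod_zero, coeff_one, Multiset.countP_zero]
    refine ⟨fun m => ?_, by simp, by simp, fun m hm => ?_⟩
    · split_ifs with h <;> simp [h]
    · rw [if_neg (by omega)]; simp
  | cons x s ih =>
    obtain ⟨M, hM, h⟩ := ih
    refine ⟨max ρ ‖x‖ * M, by positivity, ?_⟩
    rw [Multiset.map_cons, Multiset.prod_cons, Multiset.countP_cons, Multiset.countP_cons]
    exact h.X_sub_C_mul hρ hM x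

theorem exists_isPeak {ρ : ℝ} (hρ : 0 < ρ) {f : C[X]} (hf : f ≠ 0) (hs : f.Splits) :
    ∃ M > 0, IsPeak (fun m => ‖f.coeff m‖ * ρ ^ m)
      (f.roots.countP (‖·‖ < ρ)) (f.roots.countP (‖·‖ ≤ ρ)) M := by
  obtain ⟨M, hM, h1, h2, h3, h4⟩ := exists_isPeak_prod hρ f.roots
  have hc : 0 < ‖f.leadingCoeff‖ := by simpa using hf
  have h : ∀ m, ‖f.coeff m‖ * ρ ^ m = ‖f.leadingCoeff‖ *
      (‖((f.roots.map fun x => X - Polynomial.C x).prod).coeff m‖ * ρ ^ m) := fun m => by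
    conv_lhs => rw [hs.eq_prod_roots, coeff_C_mul, norm_mul]
    ring
  refine ⟨‖f.leadingCoeff‖ * M, by positivity, fun m => ?_, ?_, ?_, fun m hm => ?_⟩ <;>
    simp only [h]
  · exact mul_le_mul_of_nonneg_left (h1 m) hc.le
  · rw [← h2]
  · rw [← h3]
  · exact mul_lt_mul_of_pos_left (h4 m hm) hc

theorem logb_coeff_mul_pow {C : Type*} [NormedField C] (q : ℝ) {ρ : ℝ} (hρ : 0 < ρ) {a : C} (ha : a ≠ 0) (m : ℕ) :
    Real.logb q (‖a‖ * ρ ^ m) = Real.logb q ‖a‖ + m * Real.logb q ρ := by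
  rw [Real.logb_mul (by simpa using ha) (by positivity), Real.logb_pow]

theorem ne_zero_of_norm_mul_pow_eq {C : Type*} [NormedField C] {ρ : ℝ} {a : C} {k : ℕ} {M : ℝ} (hM : 0 < M)
    (h : ‖a‖ * ρ ^ k = M) : a ≠ 0 := by
  rintro rfl
  simp at h
  exact hM.ne h

/-- If no root lies on the circle of radius `ρ`, then the number of roots inside is the abscissa
of a vertex of the Newton polygon. -/
theorem isNewtonVertex_of_countP_eq {q : ℝ} (hq : 1 < q) {ρ : ℝ} (hρ : 0 < ρ) {f : C[X]} (hf : f ≠ 0) (hs : f.Splits)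
    {n : ℕ} (h1 : f.roots.countP (‖·‖ < ρ) = n) (h2 : f.roots.countP (‖·‖ ≤ ρ) = n) :
    IsNewtonVertex (fun x => -Real.logb q ‖x‖) f n := by
  obtain ⟨M, hM, hle, hk, -, hlt⟩ := exists_isPeak hρ hf hs
  rw [h1] at hk hlt
  rw [h2] at hlt
  simp only at hk hlt
  have hn : f.coeff n ≠ 0 := ne_zero_of_norm_mul_pow_eq hM hk
  refine ⟨hn, ?_⟩
  set p : ℝ × ℝ := ((n : ℝ), -Real.logb q ‖f.coeff n‖) with hp
  set l : ℝ := Real.logb q ρ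
  have hlM : p.2 - p.1 * l = -Real.logb q M := by
    rw [← hk, logb_coeff_mul_pow q hρ hn]; simp [hp, l]; ring
  -- The line of slope `l` through `p` supports the polygon and meets it only at `p`, because the
  -- peak is attained at `n` alone.
  have hsub : newtonPolygon (fun x => -Real.logb q ‖x‖) f ⊆
      {z | z = p ∨ -Real.logb q M < z.2 - z.1 * l} := by
    apply convexHull_min
    · rintro ⟨z1, z2⟩ ⟨m, hm, hz1, hz2⟩
      simp only at hz1 hz2
      subst hz1
      simp only [Set.mem_ofPred_eq]
      have hb := logb_coeff_mul_pow q hρ hm m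
      by_cases hmn : m = n
      · subst hmn
        rcases hz2.eq_or_lt with h | h
        · left; rw [hp, h]
        · right
          rw [← hlM]
          simp only [hp]
          linarith
      · right
        have hm' : Real.logb q (‖f.coeff m‖ * ρ ^ m) < Real.logb q M :=
          Real.logb_lt_logb hq (by positivity) (hlt m (by omega))
        linarith
    · rw [convex_iff_forall_pos]
      rintro x hx y hy a b ha hb hab
      simp only [Set.mem_ofPred_eq] at hx hy ⊢
      rw [← hlM] at hx hy ⊢
      have e : ∀ x y : ℝ × ℝ, (a • x + b • y).2 - (a • x + b • y).1 * l =
        a * (x.2 - x.1 * l) + b * (y.2 - y.1 * l) := fun x y => by simp; ring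
      rcases hx with rfl | hx <;> rcases hy with rfl | hy
      · left; rw [← add_smul, hab, one_smul]
      all_goals
        right
        rw [e]
        obtain rfl : a = 1 - b := by linarith
        nlinarith
  rw [mem_extremePoints]
  refine ⟨subset_convexHull _ _ ⟨n, hn, rfl, le_rfl⟩, ?_⟩
  rintro x hx y hy ⟨a, b, ha, hb, hab, hxy⟩
  have hx' := hsub hx
  have hy' := hsub hy
  simp only [Set.mem_ofPred_eq] at hx' hy'
  have e : a * (x.2 - x.1 * l) + b * (y.2 - y.1 * l) = p.2 - p.1 * l := by
    rw [← hxy]; simp; ring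
  rw [← hlM] at hx' hy'
  obtain rfl : a = 1 - b := by linarith
  rcases hx' with rfl | hx' <;> rcases hy' with rfl | hy'
  · exact ⟨rfl, rfl⟩
  all_goals
    exfalso
    nlinarith

/-- The abscissa of a vertex of the Newton polygon is not strictly between the numbers of roots in
the open and in the closed ball of the same radius. -/
theorem IsNewtonVertex.countP_le {q : ℝ} (hq : 1 < q) {ρ : ℝ} (hρ : 0 < ρ) {f : C[X]} (hs : f.Splits)
    {n : ℕ} (h : IsNewtonVertex (fun x => -Real.logb q ‖x‖) f n)
    (h1 : f.roots.countP (‖·‖ < ρ) < n) : f.roots.countP (‖·‖ ≤ ρ) ≤ n := by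
  obtain ⟨hn, hext⟩ := h
  have hf : f ≠ 0 := by rintro rfl; simp at hn
  obtain ⟨M, hM, hle, hk1, hk2, -⟩ := exists_isPeak hρ hf hs
  set k₁ := f.roots.countP (‖·‖ < ρ)
  set k₂ := f.roots.countP (‖·‖ ≤ ρ)
  by_contra! hlt
  simp only at hk1 hk2
  have e1 := logb_coeff_mul_pow q hρ (ne_zero_of_norm_mul_pow_eq hM hk1) k₁
  have e2 := logb_coeff_mul_pow q hρ (ne_zero_of_norm_mul_pow_eq hM hk2) k₂
  have e3 := logb_coeff_mul_pow q hρ hn n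
  have e4 : Real.logb q (‖f.coeff n‖ * ρ ^ n) ≤ Real.logb q M :=
    Real.logb_le_logb_of_le hq (by positivity) (hle n)
  rw [hk1] at e1
  rw [hk2] at e2
  have hd1 : (k₁ : ℝ) < n := by exact_mod_cast h1
  have hd2 : (n : ℝ) < k₂ := by exact_mod_cast hlt
  -- The height of the point at `n` above the line through the points at `k₁` and `k₂`. Both raised
  -- by `c ≥ 0` stay in the region, and the point at `n` is then interior to the segment joining
  -- them.
  set c := Real.logb q M - Real.logb q (‖f.coeff n‖ * ρ ^ n) with hc
  rw [mem_extremePoints] at hext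
  have := (hext.2 (k₁, -Real.logb q ‖f.coeff k₁‖ + c)
    (subset_convexHull _ _ ⟨k₁, ne_zero_of_norm_mul_pow_eq hM hk1, rfl, by simp only; linarith⟩)
    (k₂, -Real.logb q ‖f.coeff k₂‖ + c)
    (subset_convexHull _ _ ⟨k₂, ne_zero_of_norm_mul_pow_eq hM hk2, rfl, by simp only; linarith⟩) ?_).1
  · exact hd1.ne (congrArg Prod.fst this)
  · have hk : (0 : ℝ) < k₂ - k₁ := by linarith
    refine ⟨(k₂ - n) / (k₂ - k₁), (n - k₁) / (k₂ - k₁), div_pos (by linarith) hk,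
      div_pos (by linarith) hk, by field_simp; ring, ?_⟩
    ext
    · simp; field_simp; ring
    · have hc1 : -Real.logb q ‖f.coeff k₁‖ + c =
        -Real.logb q ‖f.coeff n‖ + (k₁ - n) * Real.logb q ρ := by linarith
      have hc2 : -Real.logb q ‖f.coeff k₂‖ + c =
        -Real.logb q ‖f.coeff n‖ + (k₂ - n) * Real.logb q ρ := by linarith
      simp only [hc1, hc2, Prod.smul_mk, Prod.mk_add_mk, smul_eq_mul]
      field_simp
      ring

end Newton

end Drinfeld
namespace Drinfeld

/-! ### The field `ℂ_℘` and integrality over `O` -/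

section CP

variable {Fq : Type u} [Field Fq] [Finite Fq] (P : HeightOneSpectrum Fq[X])

theorem norm_algebraMap_algCl (x : LocalField P) : ‖algebraMap (LocalField P) (AlgCl P) x‖ = ‖x‖ :=
  spectralNorm_extends (K := LocalField P) (L := AlgCl P) x

theorem norm_localToCP (x : LocalField P) : ‖localToCP P x‖ = ‖x‖ := by
  change ‖((algebraMap (LocalField P) (AlgCl P) x : AlgCl P) : CP P)‖ = _
  rw [UniformSpace.Completion.norm_coe, norm_algebraMap_algCl]

noncomputable instance : NormedAlgebra (LocalField P) (CP P) where
  __ := (localToCP P).toAlgebra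
  norm_smul_le a x := by
    change ‖localToCP P a * x‖ ≤ _
    rw [norm_mul, norm_localToCP]

instance : IsUltrametricDist (CP P) := IsUltrametricDist.of_normedAlgebra (LocalField P)

instance : IsAlgClosed (CP P) := by
  let : NontriviallyNormedField (CP P) :=
    { (inferInstance : NormedField (CP P)) with
      non_trivial := by
        obtain ⟨x, hx⟩ := NontriviallyNormedField.non_trivial (α := LocalField P)
        exact ⟨localToCP P x, by rwa [norm_localToCP]⟩ }
  let : Algebra (AlgCl P) (CP P) := (UniformSpace.Completion.coeRingHom).toAlgebra
  exact isAlgClosed_of_denseRange (K := AlgCl P) (UniformSpace.Completion.denseRange_coe)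

variable {P} {O : Subring (CP P)}

theorem IsBaseRing.isUnit_iff (hO : IsBaseRing P O) (x : O) : IsUnit x ↔ 1 ≤ ‖(x : CP P)‖ := by
  have := hO.isLocalRing
  have h := hO.mem_maximalIdeal x
  rw [IsLocalRing.mem_maximalIdeal, mem_nonunits_iff] at h
  rw [← not_lt, ← h, not_not]

/-- An element of norm greater than 1 lies outside the maximal ideal, so it is a unit. Its inverse
is a unit too and has norm at least 1, but the two norms multiply to 1. -/
theorem IsBaseRing.norm_le_one (hO : IsBaseRing P O) (x : O) : ‖(x : CP P)‖ ≤ 1 := by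
  by_contra! h
  obtain ⟨u, rfl⟩ := (hO.isUnit_iff x).2 h.le
  have h1 : 1 ≤ ‖((u⁻¹ : Oˣ) : O).1‖ := (hO.isUnit_iff _).1 (u⁻¹).isUnit
  have h2 : ((u : O) : CP P) * ((u⁻¹ : Oˣ) : O).1 = 1 := by
    rw [← Subring.coe_mul, Units.mul_inv, Subring.coe_one]
  have h3 := congrArg norm h2
  rw [norm_mul, norm_one] at h3
  nlinarith

theorem IsBaseRing.norm_eq_one (hO : IsBaseRing P O) {x : O} (hx : IsUnit x) : ‖(x : CP P)‖ = 1 :=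
  le_antisymm (hO.norm_le_one x) ((hO.isUnit_iff x).1 hx)

theorem IsBaseRing.structureMap_injective (hO : IsBaseRing P O) :
    Function.Injective hO.structureMap := by
  have h : Function.Injective ((localToCP P).comp (algebraMap Fq[X] (LocalField P))) := by
    rw [IsScalarTower.algebraMap_eq Fq[X] (RatFunc Fq) (LocalField P), RingHom.coe_comp,
      RingHom.coe_comp]
    exact (localToCP P).injective.comp
      ((algebraMap (RatFunc Fq) (LocalField P)).injective.comp (RatFunc.algebraMap_injective Fq))
  intro a b hab
  exact h (congrArg Subtype.val hab)

theorem IsBaseRing.norm_aeval_le_one (hO : IsBaseRing P O) (f : O[X]) {x : CP P} (hx : ‖x‖ ≤ 1) : ‖aeval x f‖ ≤ 1 := by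
  rw [aeval_eq_sum_range]
  refine IsUltrametricDist.norm_sum_le_of_forall_le_of_nonneg zero_le_one fun i _ => ?_
  rw [Algebra.smul_def, norm_mul, norm_pow]
  exact mul_le_one₀ (hO.norm_le_one _) (by positivity) (pow_le_one₀ (norm_nonneg _) hx)

/-- Applied to `φ_a`, this makes the balls of torsion points stable under `A`. -/
theorem IsBaseRing.norm_aeval_le (hO : IsBaseRing P O) (f : O[X]) (hf : f.coeff 0 = 0) {x : CP P} (hx : ‖x‖ ≤ 1) :
    ‖aeval x f‖ ≤ ‖x‖ := by
  obtain ⟨g, rfl⟩ := X_dvd_iff.2 hf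
  rw [map_mul, aeval_X, norm_mul]
  exact mul_le_of_le_one_right (norm_nonneg _) (hO.norm_aeval_le_one g hx)

/-- The roots of a polynomial over `O` with invertible leading coefficient are integral. -/
theorem IsBaseRing.norm_root_le_one (hO : IsBaseRing P O) {f : O[X]} (hf : IsUnit f.leadingCoeff) {x : CP P}
    (hx : aeval x f = 0) : ‖x‖ ≤ 1 := by
  by_contra! h
  have hx0 : 0 < ‖x‖ := by linarith
  rw [aeval_eq_sum_range, Finset.sum_range_succ, add_eq_zero_iff_neg_eq] at hx
  have h1 : ‖f.coeff f.natDegree • x ^ f.natDegree‖ = ‖x‖ ^ f.natDegree := by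
    rw [Algebra.smul_def, norm_mul, norm_pow]
    change ‖((f.leadingCoeff : O) : CP P)‖ * _ = _
    rw [hO.norm_eq_one hf, one_mul]
  rw [← hx, norm_neg] at h1
  rcases Nat.eq_zero_or_pos f.natDegree with h0 | h0
  · rw [h0] at h1
    simp at h1
  have h2 : ‖∑ i ∈ Finset.range f.natDegree, f.coeff i • x ^ i‖ ≤ ‖x‖ ^ (f.natDegree - 1) := by
    refine IsUltrametricDist.norm_sum_le_of_forall_le_of_nonneg (by positivity) fun i hi => ?_
    rw [Algebra.smul_def, norm_mul, norm_pow]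
    refine (mul_le_of_le_one_left (by positivity) (hO.norm_le_one _)).trans ?_
    exact pow_le_pow_right₀ h.le (by rw [Finset.mem_range] at hi; omega)
  rw [h1] at h2
  exact absurd h2 (not_le.2 (pow_lt_pow_right₀ h (by omega)))

end CP

end Drinfeld
-- Additive polynomials and torsion points
namespace Drinfeld

/-- The derivative of an additive polynomial is constant. -/
theorem derivative_of_eval_add {K : Type*} [Field K] [Infinite K] {f : K[X]}
    (hf : ∀ x y, f.eval (x + y) = f.eval x + f.eval y) :
    derivative f = Polynomial.C (f.coeff 1) := by
  refine Polynomial.funext fun x => ?_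
  have h : taylor x f = f + Polynomial.C (f.eval x) :=
    Polynomial.funext fun y => by rw [taylor_eval, hf]; simp
  rw [← taylor_coeff_one, h]
  simp

theorem nodup_roots_of_eval_add {K : Type*} [Field K] [Infinite K] {f : K[X]}
    (hf : ∀ x y, f.eval (x + y) = f.eval x + f.eval y) (h1 : f.coeff 1 ≠ 0) : f.roots.Nodup := by
  refine nodup_roots ⟨0, Polynomial.C (f.coeff 1)⁻¹, ?_⟩
  rw [derivative_of_eval_add hf, ← C_mul, inv_mul_cancel₀ h1]
  simp

namespace DrinfeldModule

variable {Fq : Type u} [Field Fq] [Finite Fq] {P : HeightOneSpectrum Fq[X]} {O : Subring (CP P)}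

section

variable {γ : Fq[X] →+* O} {r : ℕ} (φ : DrinfeldModule γ r)

theorem eval_act_add (a : Fq[X]) (x y : CP P) : ((φ.act a).map O.subtype).eval (x + y) =
    ((φ.act a).map O.subtype).eval x + ((φ.act a).map O.subtype).eval y := by
  have h := (φ.isAdditive a).aeval_add x y
  rwa [← eval_map_algebraMap, ← eval_map_algebraMap, ← eval_map_algebraMap] at h

theorem coeff_zero_act (a : Fq[X]) : (φ.act a).coeff 0 = 0 := by
  have h := (φ.isAdditive a).aeval_add (0 : O) 0
  simpa [coeff_zero_eq_aeval_zero] using h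

variable (ϖ : Fq[X])

/-- The underlying element of `ℂ_℘` of a torsion point. -/
def toCP (x : φ.torsion ϖ) : CP P := (x : φ.Points (CP P))

variable {ϖ}

theorem toCP_injective : Function.Injective (φ.toCP ϖ) := Subtype.val_injective

theorem absTorsion_eq (x : φ.torsion ϖ) : φ.absTorsion ϖ x = ‖φ.toCP ϖ x‖ := rfl

theorem aeval_toCP (x : φ.torsion ϖ) : aeval (φ.toCP ϖ x) (φ.act ϖ) = 0 :=
  (Submodule.mem_torsionBy_iff ϖ _).1 x.2

theorem exists_toCP_eq {y : CP P} (hy : aeval y (φ.act ϖ) = 0) : ∃ x : φ.torsion ϖ, φ.toCP ϖ x = y :=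
  ⟨⟨y, (Submodule.mem_torsionBy_iff ϖ _).2 hy⟩, rfl⟩

theorem toCP_smul (a : Fq[X]) (x : φ.torsion ϖ) :
    φ.toCP ϖ (Ideal.Quotient.mk (Ideal.span {ϖ}) a • x) = aeval (φ.toCP ϖ x) (φ.act a) := rfl

theorem toCP_add (x y : φ.torsion ϖ) : φ.toCP ϖ (x + y) = φ.toCP ϖ x + φ.toCP ϖ y := rfl

theorem toCP_zero : φ.toCP ϖ 0 = 0 := rfl

variable (hϖ : ϖ ≠ 0)
include hϖ

theorem act_ne_zero : φ.act ϖ ≠ 0 := fun h => by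
  have := φ.isUnit_leadingCoeff ϖ hϖ
  simp [h] at this

theorem map_act_ne_zero : (φ.act ϖ).map O.subtype ≠ 0 :=
  (Polynomial.map_ne_zero_iff O.subtype_injective).2 (φ.act_ne_zero hϖ)

theorem mem_roots_iff {y : CP P} :
    y ∈ ((φ.act ϖ).map O.subtype).roots ↔ ∃ x : φ.torsion ϖ, φ.toCP ϖ x = y := by
  rw [mem_roots (φ.map_act_ne_zero hϖ), IsRoot.def]
  change eval y ((φ.act ϖ).map (algebraMap O (CP P))) = 0 ↔ _
  rw [eval_map_algebraMap]
  exact ⟨φ.exists_toCP_eq, by rintro ⟨x, rfl⟩; exact φ.aeval_toCP x⟩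

theorem finite_torsion : Finite (φ.torsion ϖ) := by
  classical
  have h : (Set.range (φ.toCP ϖ)).Finite :=
    (((φ.act ϖ).map O.subtype).roots.toFinset.finite_toSet).subset (by
      rintro _ ⟨x, rfl⟩
      simpa using! (φ.mem_roots_iff hϖ).2 ⟨x, rfl⟩)
  have : Finite (Set.range (φ.toCP ϖ)) := h
  exact Finite.of_injective_finite_range φ.toCP_injective

end

variable {r : ℕ} {hO : IsBaseRing P O} (φ : DrinfeldModule hO.structureMap r) {ϖ : Fq[X]}
  (hϖ : ϖ ≠ 0)
include hϖ

/-- The linear coefficient is the image of `ϖ`, which is nonzero because `A` embeds in `O`. -/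
theorem nodup_roots : ((φ.act ϖ).map O.subtype).roots.Nodup := by
  have : Infinite (CP P) := IsAlgClosed.instInfinite
  refine nodup_roots_of_eval_add (φ.eval_act_add ϖ) ?_
  rw [coeff_map, φ.coeff_one, Ne, map_eq_zero_iff _ O.subtype_injective,
    map_eq_zero_iff _ hO.structureMap_injective]
  exact hϖ

/-- The bridge from Newton polygons, which count roots with multiplicity, to cardinalities of sets
of torsion points. -/
theorem countP_roots (p : ℝ → Prop) [DecidablePred p] :
    ((φ.act ϖ).map O.subtype).roots.countP (fun x => p ‖x‖) =
      Nat.card {x : φ.torsion ϖ // p (φ.absTorsion ϖ x)} := by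
  classical
  set s : Finset (CP P) := ⟨_, φ.nodup_roots hϖ⟩ with hs
  have hmem : ∀ y, y ∈ s ↔ ∃ x : φ.torsion ϖ, φ.toCP ϖ x = y := fun y => φ.mem_roots_iff hϖ
  have h : s.filter (fun x => p ‖x‖) =
      Set.image (fun x : {x : φ.torsion ϖ // p (φ.absTorsion ϖ x)} => φ.toCP ϖ x) Set.univ := by
    ext y
    simp only [Finset.coe_filter, Set.mem_ofPred_eq, hmem, Set.image_univ, Set.mem_range]
    constructor
    · rintro ⟨⟨x, rfl⟩, hx⟩; exact ⟨⟨x, hx⟩, rfl⟩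
    · rintro ⟨⟨x, hx⟩, rfl⟩; exact ⟨⟨x, rfl⟩, hx⟩
  rw [Multiset.countP_eq_card_filter]
  change (s.filter (fun x => p ‖x‖)).card = _
  rw [← Set.ncard_coe_finset, h,
    Set.ncard_image_of_injective _ fun x y hxy => Subtype.ext (φ.toCP_injective hxy),
    Set.ncard_univ]

theorem norm_toCP_le_one (x : φ.torsion ϖ) : ‖φ.toCP ϖ x‖ ≤ 1 :=
  hO.norm_root_le_one (φ.isUnit_leadingCoeff ϖ hϖ) (φ.aeval_toCP x)

/-- The torsion points in a ball around the origin. -/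
def ball {ρ : ℝ} (hρ : 0 ≤ ρ) : Submodule (Fq[X] ⧸ Ideal.span {ϖ}) (φ.torsion ϖ) where
  carrier := {x | φ.absTorsion ϖ x ≤ ρ}
  add_mem' {x y} hx hy := by
    change ‖φ.toCP ϖ (x + y)‖ ≤ ρ
    rw [φ.toCP_add]
    exact (IsUltrametricDist.norm_add_le_max _ _).trans (max_le hx hy)
  zero_mem' := by
    change ‖φ.toCP ϖ 0‖ ≤ ρ
    rwa [φ.toCP_zero, norm_zero]
  smul_mem' c x hx := by
    obtain ⟨a, rfl⟩ := Ideal.Quotient.mk_surjective c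
    change ‖φ.toCP ϖ (_ • x)‖ ≤ ρ
    rw [φ.toCP_smul]
    exact (hO.norm_aeval_le _ (φ.coeff_zero_act a) (φ.norm_toCP_le_one hϖ x)).trans hx

theorem card_torsion : Nat.card (φ.torsion ϖ) = Nat.card Fq ^ (r * ϖ.natDegree) := by
  have h := φ.countP_roots hϖ (fun _ => True)
  rw [Multiset.countP_eq_card.2 fun _ _ => trivial, ← (IsAlgClosed.splits _).natDegree_eq_card_roots,
    natDegree_map_eq_of_injective O.subtype_injective, φ.natDegree_act ϖ hϖ] at h
  rw [h]
  exact Nat.card_congr (Equiv.subtypeUnivEquiv fun _ => trivial).symm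

/-- There are finitely many torsion points and at least one is nonzero, so the infimum is a minimum
and not the default value 0 of an empty `sInf`. -/
theorem exists_absTorsion_eq_delta (hd : 0 < r * ϖ.natDegree) :
    ∃ x : φ.torsion ϖ, x ≠ 0 ∧ φ.absTorsion ϖ x = φ.delta ϖ := by
  have := φ.finite_torsion hϖ
  have hfin : {t | ∃ x : φ.torsion ϖ, x ≠ 0 ∧ φ.absTorsion ϖ x = t}.Finite :=
    (Set.finite_range (φ.absTorsion ϖ)).subset (by rintro _ ⟨x, -, rfl⟩; exact ⟨x, rfl⟩)
  refine Set.Nonempty.csInf_mem ?_ hfin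
  have : Nontrivial (φ.torsion ϖ) := by
    rw [← Finite.one_lt_card_iff_nontrivial, φ.card_torsion hϖ]
    exact Nat.one_lt_pow hd.ne' Finite.one_lt_card
  obtain ⟨x, hx⟩ := exists_ne (0 : φ.torsion ϖ)
  exact ⟨_, x, hx, rfl⟩

omit hϖ in
theorem delta_le {x : φ.torsion ϖ} (hx : x ≠ 0) : φ.delta ϖ ≤ φ.absTorsion ϖ x :=
  csInf_le ⟨0, by rintro _ ⟨y, -, rfl⟩; exact norm_nonneg _⟩ ⟨x, hx, rfl⟩

theorem delta_pos (hd : 0 < r * ϖ.natDegree) : 0 < φ.delta ϖ := by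
  obtain ⟨x, hx, h⟩ := φ.exists_absTorsion_eq_delta hϖ hd
  rw [← h, absTorsion_eq, norm_pos_iff]
  exact fun h0 => hx (φ.toCP_injective (h0.trans φ.toCP_zero.symm))

end DrinfeldModule

/-! ### The canonical submodule and the vertex criterion -/

theorem card_quotient_span {Fq : Type*} [Field Fq] [Finite Fq] {ϖ : Fq[X]} (hϖ : ϖ ≠ 0) :
    Nat.card (Fq[X] ⧸ Ideal.span {ϖ}) = Nat.card Fq ^ ϖ.natDegree := by
  have : Module.Finite Fq (Fq[X] ⧸ Ideal.span {ϖ}) := (AdjoinRoot.powerBasis hϖ).finite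
  rw [Module.natCard_eq_pow_finrank (K := Fq), finrank_quotient_span_eq_natDegree]

/-- A finite module over a finite field is free of rank one if it has the cardinality of the
field. -/
theorem rank_eq_one_iff_card {R : Type*} [CommRing R] (hR : IsField R) [Finite R] (V : Type*)
    [AddCommGroup V] [Module R V] [Finite V] :
    (Module.Free R V ∧ Module.rank R V = 1) ↔ Nat.card V = Nat.card R := by
  let : Field R := hR.toField
  rw [Module.natCard_eq_pow_finrank (K := R)]
  rw [Nat.pow_eq_self_iff Finite.one_lt_card, ← Nat.cast_one, ← Module.finrank_eq_rank, Nat.cast_inj]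
  exact ⟨fun h => h.2, fun h => ⟨inferInstance, h⟩⟩

theorem card_le_card_of_ne_zero {R : Type*} [CommRing R] (hR : IsField R) {V : Type*}
    [AddCommGroup V] [Module R V] [Finite V] {x : V} (hx : x ≠ 0) : Nat.card R ≤ Nat.card V := by
  let : Field R := hR.toField
  exact Nat.card_le_card_of_injective _ (smul_left_injective R hx)

namespace DrinfeldModule

variable {Fq : Type u} [Field Fq] [Finite Fq] {P : HeightOneSpectrum Fq[X]} {O : Subring (CP P)}
  {r : ℕ} {hO : IsBaseRing P O} (φ : DrinfeldModule hO.structureMap r) {ϖ : Fq[X]}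
  (hϖ : Irreducible ϖ)
include hϖ

theorem admitsCanonicalSubmodule_iff_card (hr : 0 < r) :
    φ.AdmitsCanonicalSubmodule ϖ ↔
      Nat.card {x : φ.torsion ϖ // φ.absTorsion ϖ x ≤ φ.delta ϖ} = Nat.card Fq ^ ϖ.natDegree := by
  have hd : 0 < r * ϖ.natDegree := Nat.mul_pos hr hϖ.natDegree_pos
  have := φ.finite_torsion hϖ.ne_zero
  have hR : IsField (Fq[X] ⧸ Ideal.span {ϖ}) :=
    (Ideal.Quotient.maximal_ideal_iff_isField_quotient _).1
      (PrincipalIdealRing.isMaximal_of_irreducible hϖ)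
  have hcard := card_quotient_span hϖ.ne_zero
  have : Finite (Fq[X] ⧸ Ideal.span {ϖ}) := Nat.finite_of_card_ne_zero (by
    rw [hcard]; exact (pow_pos Finite.card_pos _).ne')
  rw [← hcard]
  constructor
  · rintro ⟨N, hN, h⟩
    rw [rank_eq_one_iff_card hR N] at h
    rw [← h]
    exact Nat.card_congr (Equiv.setCongr hN.symm)
  · intro h
    refine ⟨φ.ball hϖ.ne_zero (φ.delta_pos hϖ.ne_zero hd).le, rfl, ?_⟩
    exact (rank_eq_one_iff_card hR (φ.ball hϖ.ne_zero (φ.delta_pos hϖ.ne_zero hd).le)).2 h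

/-- The ball of radius `δ₀` has at least as many elements as the residue field. -/
theorem card_le_card_delta (hr : 0 < r) : Nat.card Fq ^ ϖ.natDegree ≤
    Nat.card {x : φ.torsion ϖ // φ.absTorsion ϖ x ≤ φ.delta ϖ} := by
  have hd : 0 < r * ϖ.natDegree := Nat.mul_pos hr hϖ.natDegree_pos
  have := φ.finite_torsion hϖ.ne_zero
  have hR : IsField (Fq[X] ⧸ Ideal.span {ϖ}) :=
    (Ideal.Quotient.maximal_ideal_iff_isField_quotient _).1
      (PrincipalIdealRing.isMaximal_of_irreducible hϖ)
  obtain ⟨x, hx, h⟩ := φ.exists_absTorsion_eq_delta hϖ.ne_zero hd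
  rw [← card_quotient_span hϖ.ne_zero]
  exact card_le_card_of_ne_zero hR (V := φ.ball hϖ.ne_zero (φ.delta_pos hϖ.ne_zero hd).le)
    (x := ⟨x, h.le⟩) fun h0 => hx (congrArg Subtype.val h0)

/-- Forwards, the root counts are compared at a radius just above `δ₀`; backwards, at `δ₀` itself,
where the open ball has one point and `1 < q^d`. -/
theorem admitsCanonicalSubmodule_iff (hr : 0 < r) :
    φ.AdmitsCanonicalSubmodule ϖ ↔
      IsNewtonVertex (val P) ((φ.act ϖ).map O.subtype) (Nat.card Fq ^ ϖ.natDegree) := by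
  have hd : 0 < r * ϖ.natDegree := Nat.mul_pos hr hϖ.natDegree_pos
  have := φ.finite_torsion hϖ.ne_zero
  have hq : (1 : ℝ) < Nat.card Fq := by exact_mod_cast Finite.one_lt_card
  have hs : ((φ.act ϖ).map O.subtype).Splits := IsAlgClosed.splits _
  have hδ := φ.delta_pos hϖ.ne_zero hd
  rw [φ.admitsCanonicalSubmodule_iff_card hϖ hr]
  constructor
  · intro h
    -- Finitely many absolute values occur, so some `ρ > δ₀` lies below all those exceeding `δ₀`.
    -- The open and closed balls of radius `ρ` then both equal the closed ball of radius `δ₀`.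
    obtain ⟨ρ, hρ, hgap⟩ : ∃ ρ, φ.delta ϖ < ρ ∧
        ∀ x, φ.absTorsion ϖ x ≤ ρ → φ.absTorsion ϖ x ≤ φ.delta ϖ := by
      have hf : {t | t ∈ Set.range (φ.absTorsion ϖ) ∧ φ.delta ϖ < t}.Finite :=
        (Set.finite_range (φ.absTorsion ϖ)).subset fun t ht => ht.1
      rcases Set.eq_empty_or_nonempty {t | t ∈ Set.range (φ.absTorsion ϖ) ∧ φ.delta ϖ < t} with
        he | hne
      · refine ⟨φ.delta ϖ + 1, by linarith, fun x _ => ?_⟩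
        by_contra! hx
        exact (Set.eq_empty_iff_forall_notMem.1 he _) ⟨⟨x, rfl⟩, hx⟩
      · obtain ⟨t, ⟨-, ht⟩, hmin⟩ := Set.exists_min_image _ id hf hne
        obtain ⟨ρ, h1, h2⟩ := exists_between ht
        refine ⟨ρ, h1, fun x hx => ?_⟩
        by_contra! hx'
        exact absurd (hmin _ ⟨⟨x, rfl⟩, hx'⟩) (not_le.2 (hx.trans_lt h2))
    refine isNewtonVertex_of_countP_eq hq (hδ.trans hρ) (φ.map_act_ne_zero hϖ.ne_zero) hs ?_ ?_
    · rw [φ.countP_roots hϖ.ne_zero (· < ρ), ← h]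
      exact Nat.card_congr (Equiv.subtypeEquivRight fun x =>
        ⟨fun hx => hgap x hx.le, fun hx => hx.trans_lt hρ⟩)
    · rw [φ.countP_roots hϖ.ne_zero (· ≤ ρ), ← h]
      exact Nat.card_congr (Equiv.subtypeEquivRight fun x => ⟨hgap x, fun hx => hx.trans hρ.le⟩)
  · intro h
    refine le_antisymm ?_ (φ.card_le_card_delta hϖ hr)
    rw [← φ.countP_roots hϖ.ne_zero (· ≤ φ.delta ϖ)]
    refine h.countP_le hq hδ hs ?_
    rw [φ.countP_roots hϖ.ne_zero (· < φ.delta ϖ)]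
    have : Subsingleton {x : φ.torsion ϖ // φ.absTorsion ϖ x < φ.delta ϖ} := by
      have h0 : ∀ x : {x : φ.torsion ϖ // φ.absTorsion ϖ x < φ.delta ϖ}, x.1 = 0 := fun x => by
        by_contra hx
        exact absurd (φ.delta_le hx) (not_le.2 x.2)
      exact ⟨fun x y => Subtype.ext ((h0 x).trans (h0 y).symm)⟩
    exact (Finite.card_le_one_iff_subsingleton.2 this).trans_lt
      (Nat.one_lt_pow hϖ.natDegree_pos.ne' Finite.one_lt_card)

end DrinfeldModule

end Drinfeld
namespace Drinfeld

/-! ### Descent to `O` of the factor with roots in a ball -/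

section Descent

/-- Over a closed subfield of a complete nonarchimedean field, all roots of a minimal polynomial
have the same absolute value. -/
theorem norm_eq_of_minpoly_root_subfield {C : Type*} [NormedField C] [CompleteSpace C]
    [IsUltrametricDist C] (L : Subfield C) (hL : IsClosed (L : Set C)) (hL1 : ∃ t ∈ L, 1 < ‖t‖)
    {x y : C} (hx : IsIntegral L x) (hy : aeval y (minpoly L x) = 0) : ‖y‖ = ‖x‖ := by
  let : NontriviallyNormedField L :=
    { (inferInstance : NormedField L) with
      non_trivial := by
        obtain ⟨t, ht, h⟩ := hL1
        exact ⟨⟨t, ht⟩, h⟩ }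
  let : NormedAlgebra L C :=
    { (inferInstance : Algebra L C) with
      norm_smul_le := fun a z => by
        rw [Algebra.smul_def, norm_mul]
        exact le_rfl }
  have : CompleteSpace L := hL.completeSpace_coe
  have : IsUltrametricDist L := ⟨fun a b c => IsUltrametricDist.dist_triangle_max (a : C) b c⟩
  exact norm_eq_of_minpoly_root hx hy

/-- A separable polynomial over a closed subfield has a monic factor over the same subfield, whose
roots are the roots in a given ball. -/
theorem exists_monic_dvd_roots_le {C : Type*} [NormedField C] [CompleteSpace C]
    [IsUltrametricDist C] (L : Subfield C) (hL : IsClosed (L : Set C)) (hL1 : ∃ t ∈ L, 1 < ‖t‖)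
    {f : L[X]} (hf : f ≠ 0) (δ : ℝ) :
    ∃ h : L[X], h.Monic ∧ h ∣ f ∧ ∀ y : C, aeval y h = 0 ↔ aeval y f = 0 ∧ ‖y‖ ≤ δ := by
  let S : Set L[X] :=
    {p | p.Monic ∧ p ∣ f ∧ ∀ y : C, aeval y f = 0 → ‖y‖ ≤ δ → aeval y p = 0}
  have hu : IsUnit (Polynomial.C f.leadingCoeff⁻¹) :=
    isUnit_C.2 (by simpa using hf)
  have hS : S.Nonempty := ⟨f * Polynomial.C f.leadingCoeff⁻¹, monic_mul_leadingCoeff_inv hf,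
    (hu.mul_right_dvd).2 dvd_rfl, fun y hy _ => by rw [map_mul, hy, zero_mul]⟩
  obtain ⟨h, ⟨hmon, hdvd, hvan⟩, hmin⟩ :=
    exists_minimalFor_of_wellFoundedLT (· ∈ S) Polynomial.natDegree hS
  refine ⟨h, hmon, hdvd, fun y => ⟨fun hy => ?_, fun hy => hvan y hy.1 hy.2⟩⟩
  have hyf : aeval y f = 0 := by
    obtain ⟨g, rfl⟩ := hdvd
    rw [map_mul, hy, zero_mul]
  refine ⟨hyf, ?_⟩
  -- The conjugates of a root `y` outside the ball all lie outside it. Dividing by the minimal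
  -- polynomial of `y` loses no root in the ball and lowers the degree, against minimality.
  by_contra! hlt
  have hint : IsIntegral L y := ⟨h, hmon, hy⟩
  obtain ⟨g, rfl⟩ := minpoly.dvd L y hy
  have hg : g.Monic := (minpoly.monic hint).of_mul_monic_left hmon
  have hgS : g ∈ S := by
    refine ⟨hg, (dvd_mul_left _ _).trans hdvd, fun z hz hzδ => ?_⟩
    have h0 := hvan z hz hzδ
    rw [map_mul, mul_eq_zero] at h0
    refine h0.resolve_left fun h1 => ?_
    have := norm_eq_of_minpoly_root_subfield L hL hL1 hint h1
    linarith
  have hdeg := hmin hgS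
  rw [(minpoly.monic hint).natDegree_mul hg] at hdeg
  have := minpoly.natDegree_pos hint
  have hle : g.natDegree ≤ (minpoly L y).natDegree + g.natDegree := by omega
  have := hdeg hle
  omega

/-- A monic polynomial with integral roots has integral coefficients. -/
theorem norm_coeff_le_one {C : Type u} [NormedField C] [IsUltrametricDist C] {f : C[X]}
    (hf : f.Monic) (hs : f.Splits) (hroots : ∀ x ∈ f.roots, ‖x‖ ≤ 1) (n : ℕ) :
    ‖f.coeff n‖ ≤ 1 := by
  -- At radius 1 all roots lie in the closed ball, so the peak is attained by the leading
  -- coefficient 1.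
  obtain ⟨M, -, hle, -, h2, -⟩ := exists_isPeak one_pos hf.ne_zero hs
  rw [Multiset.countP_eq_card.2 hroots, ← hs.natDegree_eq_card_roots] at h2
  have := hle n
  simp only [one_pow, mul_one, coeff_natDegree, hf.leadingCoeff, norm_one] at this h2
  rwa [h2]

end Descent

section FractionField

variable {Fq : Type u} [Field Fq] [Finite Fq] {P : HeightOneSpectrum Fq[X]} {O : Subring (CP P)}

/-- For a fraction `y / z`, either `z` divides `y`, or `z = y c` and the bound on the norm forces
`c` to be a unit. So `O` is the whole unit ball of its fraction field. -/
theorem IsBaseRing.mem_of_mem_closure (hO : IsBaseRing P O) (hV : ValuationRing O) {x : CP P}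
    (hx : x ∈ Subfield.closure (O : Set (CP P))) (hx1 : ‖x‖ ≤ 1) : x ∈ O := by
  rw [Subfield.mem_closure_iff, Subring.closure_eq] at hx
  obtain ⟨y, hy, z, hz, rfl⟩ := hx
  rcases eq_or_ne z 0 with rfl | hz0
  · simp
  rcases eq_or_ne y 0 with rfl | hy0
  · simp
  rcases ValuationRing.dvd_total (⟨y, hy⟩ : O) ⟨z, hz⟩ with ⟨c, hc⟩ | ⟨c, hc⟩
  · have hc : z = y * c := congrArg Subtype.val hc
    have hc0 : (c : CP P) ≠ 0 := by rintro h; simp [h] at hc; exact hz0 hc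
    have hyz : y / z = (c : CP P)⁻¹ := by rw [hc]; field_simp
    rw [hyz, norm_inv] at hx1
    have hu : IsUnit c := by
      rw [hO.isUnit_iff]
      exact (inv_le_one₀ (norm_pos_iff.2 hc0)).1 hx1
    obtain ⟨u, rfl⟩ := hu
    have h2 : ((u : O) : CP P) * ((u⁻¹ : Oˣ) : O).1 = 1 := by
      rw [← Subring.coe_mul, Units.mul_inv, Subring.coe_one]
    rw [hyz, ← eq_inv_of_mul_eq_one_right h2]
    exact Subtype.prop _
  · have hc : y = z * c := congrArg Subtype.val hc
    rw [hc, mul_div_cancel_left₀ _ hz0]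
    exact c.2

/-- A limit `x` of fractions differs by less than 1 from some fraction `y`. Then `x - y` is a limit
of elements of the unit ball, which is `O`, and `O` is complete. -/
theorem IsBaseRing.isClosed_closure (hO : IsBaseRing P O) (hV : ValuationRing O) :
    IsClosed (Subfield.closure (O : Set (CP P)) : Set (CP P)) := by
  refine isClosed_of_closure_subset fun x hx => ?_
  obtain ⟨y, hy, hxy⟩ := Metric.mem_closure_iff.1 hx 1 one_pos
  suffices h : x - y ∈ O by
    have := add_mem (Subfield.subset_closure h) hy
    rwa [sub_add_cancel] at this
  have hcl : IsClosed (O : Set (CP P)) := hO.isComplete.isClosed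
  change x - y ∈ (O : Set (CP P))
  rw [← hcl.closure_eq, Metric.mem_closure_iff]
  intro ε hε
  obtain ⟨z, hz, hxz⟩ := Metric.mem_closure_iff.1 hx (min ε 1) (lt_min hε one_pos)
  rw [dist_eq_norm] at hxy hxz
  refine ⟨z - y, hO.mem_of_mem_closure hV (sub_mem hz hy) ?_, ?_⟩
  · rw [← sub_sub_sub_cancel_left y z x]
    exact norm_sub_le' hxy.le (hxz.le.trans (min_le_right _ _))
  · rw [dist_eq_norm, sub_sub_sub_cancel_right]
    exact hxz.trans_le (min_le_left _ _)

theorem IsBaseRing.exists_one_lt_norm (hO : IsBaseRing P O) :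
    ∃ t ∈ Subfield.closure (O : Set (CP P)), 1 < ‖t‖ := by
  obtain ⟨a, ha⟩ := NontriviallyNormedField.non_trivial (α := LocalField P)
  refine ⟨localToCP P a, ?_, by rwa [norm_localToCP]⟩
  rw [← inv_inv a, map_inv₀]
  refine inv_mem (Subfield.subset_closure (hO.integers_mem _ ?_))
  rw [HeightOneSpectrum.mem_adicCompletionIntegers]
  refine Valued.toNormedField.norm_le_one_iff.1 ?_
  rw [norm_inv]
  exact inv_le_one_of_one_le₀ ha.le

/-- A polynomial over `O` with invertible leading coefficient has a monic factor over `O`, whose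
roots are the roots in a given ball. -/
theorem IsBaseRing.exists_monic (hO : IsBaseRing P O) (hV : ValuationRing O) {f : O[X]}
    (hf : IsUnit f.leadingCoeff) (hnd : (f.map O.subtype).roots.Nodup) (δ : ℝ) :
    ∃ h : O[X], h.Monic ∧ (h.map O.subtype).roots.Nodup ∧
      ∀ y : CP P, aeval y h = 0 ↔ aeval y f = 0 ∧ ‖y‖ ≤ δ := by
  let L := Subfield.closure (O : Set (CP P))
  let i : O →+* L := Subring.inclusion (S := O) (T := L.toSubring) Subfield.subset_closure
  have hi : (algebraMap L (CP P)).comp i = O.subtype := rfl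
  have hi_inj : Function.Injective i := Set.inclusion_injective Subfield.subset_closure
  have hf0 : f ≠ 0 := by rintro rfl; simp at hf
  have hfL : f.map i ≠ 0 := (Polynomial.map_ne_zero_iff hi_inj).2 hf0
  have hfC : f.map O.subtype ≠ 0 := (Polynomial.map_ne_zero_iff O.subtype_injective).2 hf0
  obtain ⟨h, hmon, hdvd, hroots⟩ := exists_monic_dvd_roots_le L (hO.isClosed_closure hV)
    hO.exists_one_lt_norm hfL δ
  have hfe : ∀ y : CP P, aeval y (f.map i) = aeval y f := fun y => by
    rw [← eval_map_algebraMap, Polynomial.map_map, hi, ← eval_map_algebraMap]; rfl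
  simp only [hfe] at hroots
  have hlift : h ∈ lifts i := by
    rw [lifts_iff_coeff_lifts]
    intro n
    refine ⟨⟨h.coeff n, hO.mem_of_mem_closure hV (h.coeff n).2 ?_⟩, rfl⟩
    have := norm_coeff_le_one (hmon.map (algebraMap L (CP P))) (IsAlgClosed.splits _)
      (fun x hx => by
        rw [mem_roots (hmon.map _).ne_zero, IsRoot.def, eval_map_algebraMap, hroots] at hx
        exact hO.norm_root_le_one hf hx.1) n
    rwa [coeff_map] at this
  obtain ⟨g, rfl, -, hg⟩ := lifts_and_natDegree_eq_and_monic hlift hmon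
  refine ⟨g, hg, ?_, fun y => ?_⟩
  · refine Multiset.nodup_of_le (roots.le_of_dvd hfC ?_) hnd
    have := Polynomial.map_dvd (algebraMap L (CP P)) hdvd
    rwa [Polynomial.map_map, Polynomial.map_map, hi] at this
  · rw [← hroots, ← eval_map_algebraMap, ← eval_map_algebraMap, Polynomial.map_map, hi]; rfl

end FractionField

/-! ### Additive polynomials and submodule schemes from groups of roots -/

section AdditiveProduct

theorem dvd_of_roots_subset {K : Type*} [Field K] {h g : K[X]} (h0 : h ≠ 0) (hs : h.Splits)
    (hnd : h.roots.Nodup) (hg : ∀ x, h.eval x = 0 → g.eval x = 0) : h ∣ g := by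
  rcases eq_or_ne g 0 with rfl | hg0
  · exact dvd_zero _
  refine hs.dvd_of_roots_le_roots h0 ((Multiset.le_iff_subset hnd).2 fun x hx => ?_)
  rw [mem_roots h0] at hx
  rw [mem_roots hg0]
  exact hg x hx

/-- A separable monic polynomial whose roots form a group is additive. -/
theorem eval_add_of_roots {K : Type*} [Field K] {h : K[X]} (hmon : h.Monic) (hs : h.Splits)
    (hnd : h.roots.Nodup) (h0 : h.eval 0 = 0)
    (hadd : ∀ x y, h.eval x = 0 → h.eval y = 0 → h.eval (x + y) = 0) (x y : K) :
    h.eval (x + y) = h.eval x + h.eval y := by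
  have hdeg : ∀ y, (taylor y h - h).degree < h.degree := fun y => by
    have hd : (taylor y h).degree = h.degree := degree_taylor h y
    rw [← hd]
    exact degree_sub_lt_left hd (by rw [Ne, ← degree_eq_bot, hd, degree_eq_bot]; exact hmon.ne_zero)
      (leadingCoeff_taylor _ _)
  -- Translation by a root permutes the roots, so `h(X + x) - h(X)` vanishes at all of them; its
  -- degree is smaller than that of `h`, so it is zero.
  have hinv : ∀ x y, h.eval x = 0 → h.eval (y + x) = h.eval y := fun x y hx => by
    have : taylor x h - h = 0 := by
      refine eq_zero_of_dvd_of_degree_lt (dvd_of_roots_subset hmon.ne_zero hs hnd fun z hz => ?_)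
        (hdeg x)
      rw [eval_sub, taylor_eval, hadd z x hz hx, hz, sub_zero]
    rw [← taylor_eval, sub_eq_zero.1 this]
  have hpos : 0 < h.degree := by
    rw [← natDegree_pos_iff_degree_pos, Nat.pos_iff_ne_zero]
    intro hd
    rw [hmon.natDegree_eq_zero.1 hd] at h0
    simp at h0
  -- The same argument for arbitrary `y`: by the invariance just shown, the difference vanishes at
  -- every root of `h`.
  have : taylor y h - h - Polynomial.C (h.eval y) = 0 := by
    refine eq_zero_of_dvd_of_degree_lt (dvd_of_roots_subset hmon.ne_zero hs hnd fun z hz => ?_)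
      ((degree_sub_le _ _).trans_lt (max_lt (hdeg y) (degree_C_le.trans_lt hpos)))
    rw [eval_sub, eval_sub, taylor_eval, eval_C, add_comm z y, hinv z y hz, hz]
    ring
  have h2 := congrArg (eval x) this
  rw [eval_sub, eval_sub, taylor_eval, eval_C, eval_zero] at h2
  linear_combination h2

/-- Additivity is an identity of polynomials in two variables, which may be tested on the points of
an infinite field containing `R`. -/
theorem isAdditive_of_eval_add {R K : Type u} [CommRing R] [Field K] [Infinite K] [Algebra R K]
    (hinj : Function.Injective (algebraMap R K)) {h : R[X]}
    (hadd : ∀ x y : K, aeval (x + y) h = aeval x h + aeval y h) : IsAdditive h := by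
  refine MvPolynomial.map_injective _ hinj (MvPolynomial.funext fun z => ?_)
  simp only [MvPolynomial.eval_map, ← MvPolynomial.aeval_def, map_add, ← aeval_algHom_apply,
    MvPolynomial.aeval_X]
  exact hadd _ _

end AdditiveProduct

namespace DrinfeldModule

variable {Fq : Type u} [Field Fq] {R : Type u} [CommRing R] {γ : Fq[X] →+* R} {r : ℕ}
  (φ : DrinfeldModule γ r)

/-- The submodule scheme defined by an additive polynomial `h` that divides `φ_ϖ` and all
`h ∘ φ_a`. -/
noncomputable def SubmoduleScheme.ofAdditive {ϖ : Fq[X]} {h : R[X]} (hadd : IsAdditive h) (hdvd : h ∣ φ.act ϖ)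
    (hcomp : ∀ a, h ∣ h.comp (φ.act a)) : φ.SubmoduleScheme ϖ where
  ideal := Ideal.span {h}
  act_mem := Ideal.mem_span_singleton.2 hdvd
  isSubmodule S _ _ := by
    have h0 : aeval (0 : S) h = 0 := by simpa using hadd.aeval_add (0 : S) 0
    refine ⟨{ carrier := {x : S | aeval x h = 0}
              add_mem' := fun {x y} hx hy => ?_
              zero_mem' := h0
              smul_mem' := fun a x hx => ?_ }, ?_⟩
    · exact (hadd.aeval_add (S := S) x y).trans (by
        rw [show aeval (show S from x) h = 0 from hx, show aeval (show S from y) h = 0 from hy,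
          add_zero])
    · change aeval (aeval (show S from x) (φ.act a) : S) h = 0
      rw [← aeval_comp]
      exact aeval_eq_zero_of_dvd_aeval_eq_zero (hcomp a) hx
    · ext x
      refine ⟨fun hx f hf => ?_, fun hx => hx h (Ideal.mem_span_singleton_self h)⟩
      exact aeval_eq_zero_of_dvd_aeval_eq_zero (Ideal.mem_span_singleton.1 hf) hx

theorem SubmoduleScheme.mem_points_ofAdditive {ϖ : Fq[X]} {h : R[X]} (hadd : IsAdditive h)
    (hdvd : h ∣ φ.act ϖ) (hcomp : ∀ a, h ∣ h.comp (φ.act a)) {S : Type u} [CommRing S]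
    [Algebra R S] (x : S) :
    x ∈ (SubmoduleScheme.ofAdditive φ hadd hdvd hcomp).points S ↔ aeval x h = 0 :=
  ⟨fun hx => hx h (Ideal.mem_span_singleton_self h), fun hx _ hf =>
    aeval_eq_zero_of_dvd_aeval_eq_zero (Ideal.mem_span_singleton.1 hf) hx⟩

end DrinfeldModule

theorem finite_and_flat_of_monic {R : Type*} [CommRing R] {h : R[X]} (hmon : h.Monic) :
    Module.Finite R (R[X] ⧸ Ideal.span {h}) ∧ Module.Flat R (R[X] ⧸ Ideal.span {h}) := by
  let b := AdjoinRoot.powerBasis' hmon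
  have h1 : Module.Finite R (AdjoinRoot h) := b.finite
  have h2 : Module.Free R (AdjoinRoot h) := Module.Free.of_basis b.basis
  exact ⟨h1, inferInstanceAs (Module.Flat R (AdjoinRoot h))⟩

/-! ### The canonical submodule scheme over a valuation ring -/

namespace DrinfeldModule

variable {Fq : Type u} [Field Fq] [Finite Fq] {P : HeightOneSpectrum Fq[X]} {O : Subring (CP P)}
  {r : ℕ} {hO : IsBaseRing P O} {ϖ : Fq[X]}

/-- Over a valuation ring, the canonical submodule extends to a finite flat submodule scheme. -/
theorem AdmitsCanonicalSubmodule.admitsFiniteFlat {φ : DrinfeldModule hO.structureMap r}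
    (hϖ : ϖ ≠ 0) (hV : ValuationRing O) (hφ : φ.AdmitsCanonicalSubmodule ϖ) :
    φ.AdmitsFiniteFlatCanonicalSubmoduleScheme ϖ := by
  obtain ⟨N, hN⟩ := hφ
  obtain ⟨h, hmon, hnd, hroots⟩ := hO.exists_monic hV (φ.isUnit_leadingCoeff ϖ hϖ)
    (φ.nodup_roots hϖ) (φ.delta ϖ)
  have : Infinite (CP P) := IsAlgClosed.instInfinite
  have hmonC : (h.map O.subtype).Monic := hmon.map _
  have hs : (h.map O.subtype).Splits := IsAlgClosed.splits _
  have heval : ∀ (p : O[X]) (y : CP P), (p.map O.subtype).eval y = aeval y p := fun p y =>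
    eval_map_algebraMap p y
  have hmem : ∀ y : CP P, aeval y h = 0 ↔ ∃ x ∈ N, φ.toCP ϖ x = y := fun y => by
    rw [hroots]
    constructor
    · rintro ⟨hy, hyδ⟩
      obtain ⟨x, rfl⟩ := φ.exists_toCP_eq hy
      refine ⟨x, ?_, rfl⟩
      change x ∈ (N : Set (φ.torsion ϖ))
      rw [hN.1]
      exact hyδ
    · rintro ⟨x, hx, rfl⟩
      change x ∈ (N : Set (φ.torsion ϖ)) at hx
      rw [hN.1] at hx
      exact ⟨φ.aeval_toCP x, hx⟩
  have haddC := eval_add_of_roots hmonC hs hnd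
    (by rw [heval, hmem]; exact ⟨0, N.zero_mem, φ.toCP_zero⟩)
    (fun x y hx hy => by
      rw [heval, hmem] at hx hy ⊢
      obtain ⟨x, hx, rfl⟩ := hx
      obtain ⟨y, hy, rfl⟩ := hy
      exact ⟨x + y, N.add_mem hx hy, φ.toCP_add x y⟩)
  simp only [heval] at haddC
  have hadd : IsAdditive h := isAdditive_of_eval_add O.subtype_injective haddC
  -- As `h` is monic, divisibility over `ℂ_℘` descends to `O`; over `ℂ_℘` the simple roots of `h`
  -- decide it.
  have hdvd_of : ∀ g : O[X], (∀ x ∈ N, aeval (φ.toCP ϖ x) g = 0) → h ∣ g := fun g hg => by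
    rw [← map_dvd_map O.subtype O.subtype_injective hmon]
    refine dvd_of_roots_subset hmonC.ne_zero hs hnd fun y hy => ?_
    rw [heval, hmem] at hy
    obtain ⟨x, hx, rfl⟩ := hy
    rw [heval, hg x hx]
  have hdvd : h ∣ φ.act ϖ := hdvd_of _ fun x _ => φ.aeval_toCP x
  have hcomp : ∀ a, h ∣ h.comp (φ.act a) := fun a => hdvd_of _ fun x hx => by
    rw [aeval_comp, ← φ.toCP_smul, hmem]
    exact ⟨_, N.smul_mem _ hx, rfl⟩
  refine ⟨SubmoduleScheme.ofAdditive φ hadd hdvd hcomp, ⟨N, hN, ?_⟩, finite_and_flat_of_monic hmon⟩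
  ext y
  exact (SubmoduleScheme.mem_points_ofAdditive φ hadd hdvd hcomp (S := CP P) y).trans (hmem y)

end DrinfeldModule

end Drinfeld

/-! ### The theorem -/

theorem mainTheorem2 {Fq : Type u} [Field Fq] [Finite Fq] (P : HeightOneSpectrum Fq[X])
    (ϖ : Fq[X]) (hmonic : ϖ.Monic) (hP : P.asIdeal = Ideal.span {ϖ})
    (O : Subring (Drinfeld.CP P)) (hO : Drinfeld.IsBaseRing P O) (r : ℕ) (hr : 2 ≤ r)
    (φ : Drinfeld.DrinfeldModule hO.structureMap r) :
    (φ.AdmitsCanonicalSubmodule ϖ ↔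
      Drinfeld.IsNewtonVertex (Drinfeld.val P) ((φ.act ϖ).map O.subtype)
        (Nat.card Fq ^ ϖ.natDegree)) ∧
    (φ.AdmitsCanonicalSubmoduleScheme ϖ →
      Drinfeld.IsNewtonVertex (Drinfeld.val P) ((φ.act ϖ).map O.subtype)
        (Nat.card Fq ^ ϖ.natDegree)) ∧
    (ValuationRing O →
      (φ.AdmitsCanonicalSubmoduleScheme ϖ ↔
        Drinfeld.IsNewtonVertex (Drinfeld.val P) ((φ.act ϖ).map O.subtype)
          (Nat.card Fq ^ ϖ.natDegree)) ∧
      (φ.AdmitsFiniteFlatCanonicalSubmoduleScheme ϖ ↔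
        Drinfeld.IsNewtonVertex (Drinfeld.val P) ((φ.act ϖ).map O.subtype)
          (Nat.card Fq ^ ϖ.natDegree))) := by
  have hϖ : Irreducible ϖ := by
    have hprime := P.isPrime
    rw [hP, Ideal.span_singleton_prime hmonic.ne_zero] at hprime
    exact hprime.irreducible
  have h1 := φ.admitsCanonicalSubmodule_iff hϖ (by omega)
  have h2 : φ.AdmitsCanonicalSubmoduleScheme ϖ → φ.AdmitsCanonicalSubmodule ϖ :=
    fun ⟨_, N, hN, _⟩ => ⟨N, hN⟩
  have h3 : φ.AdmitsFiniteFlatCanonicalSubmoduleScheme ϖ → φ.AdmitsCanonicalSubmoduleScheme ϖ :=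
    fun ⟨Z, hZ, _⟩ => ⟨Z, hZ⟩
  refine ⟨h1, fun h => h1.1 (h2 h), fun hV => ?_⟩
  have h4 : φ.AdmitsCanonicalSubmodule ϖ → φ.AdmitsFiniteFlatCanonicalSubmoduleScheme ϖ :=
    fun h => h.admitsFiniteFlat hϖ.ne_zero hV
  exact ⟨⟨fun h => h1.1 (h2 h), fun h => h3 (h4 (h1.2 h))⟩,
    ⟨fun h => h1.1 (h2 (h3 h)), fun h => h4 (h1.2 h)⟩⟩
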